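/- Let $(R,\mathfrak m)$ be a Noetherian local ring of dimension $d\ge 1$, and let $S/R$ be a finite cover, that is, a (commutative) ring extension $R\subseteq S$ such that $S$ is a finite $R$-module. Assume that at least one of the following holds: (i) $S/R$ is of finite length, i.e. the $R$-module $S/R$ has finite length; (ii) $S/R$ is birational, i.e. $R$ is reduced and $S$ is contained in the total quotient ring of $R$. Let $I$ be an $\mathfrak m$-primary ideal of $R$, and let $\mathcal B=\{\mathcal B_n\}_{n\ge0}$ be a filtration of ideals of $R$ (that is, $\mathcal B_0=R$, $\mathcal B_{n+1}\subseteq\mathcal B_n$ and $\mathcal B_m\mathcal B_n\subseteq\mathcal B_{m+n}$ for all $m,n\ge 0$) which is $I$-admissible, i.e. there is an integer $k\ge0$ with $\mathcal B_{n+k}\subseteq I^n\subseteq \mathcal B_n$ for all $n\ge0$. Assume that $R\cap I^nS\subseteq\mathcal B_n$ for all $n\gg0$. Let $\lambda$ denote length as an $R$-module. Then there are polynomials $P_{\mathcal B},P_{I,S}\in\mathbb Q[X]$, of positive degree, with $P_{\mathcal B}(n)=\lambda(R/\mathcal B_{n+1})$ and $P_{I,S}(n)=\lambda(S/I^{n+1}S)$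 for $n\gg0$, all these lengths being finite. For $P$ equal to either of them, with $r=\deg P$, there are unique integers $e_i(P)$ such that $$P=\sum_{i=0}^{r}(-1)^i e_i(P)\binom{X+r-i}{r-i},$$ and, writing $e_1(\mathcal B)=e_1(P_{\mathcal B})$ and $e_1(I,S)=e_1(P_{I,S})$, one has $$e_1(\mathcal B)\ \ge\ e_1(I,S).$$ -/

import Mathlib

noncomputable section

namespace ChernNumber

/-! ### Hilbert polynomials and Hilbert coefficients -/

/-- `P` is the polynomial associated to the length function `f`: for all large `n` the length
`f n` is finite and equals `P(n)`. -/
def IsHilbertPolynomial (f : ℕ → ℕ∞) (P : Polynomial ℚ) : Prop :=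
  ∀ᶠ n : ℕ in Filter.atTop, ∃ a : ℕ, f n = (a : ℕ∞) ∧ P.eval (n : ℚ) = (a : ℚ)

/-- The polynomial associated to `f` is unique. -/
theorem IsHilbertPolynomial.unique {f : ℕ → ℕ∞} {P Q : Polynomial ℚ}
    (hP : IsHilbertPolynomial f P) (hQ : IsHilbertPolynomial f Q) : P = Q := by
  have h : ∀ᶠ n : ℕ in Filter.atTop, P.eval (n : ℚ) = Q.eval (n : ℚ) := by
    filter_upwards [hP, hQ] with n ⟨a, ha, hPa⟩ ⟨b, hb, hQb⟩
    have hab : a = b := by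
      have : (a : ℕ∞) = b := ha.symm.trans hb
      exact_mod_cast this
    rw [hPa, hQb, hab]
  obtain ⟨N, hN⟩ := Filter.eventually_atTop.1 h
  refine Polynomial.eq_of_infinite_eval_eq P Q ?_
  refine ((Set.Ici_infinite N).image (Nat.cast_injective (R := ℚ)).injOn).mono ?_
  rintro _ ⟨n, hn, rfl⟩
  exact hN n hn

open Classical in
/-- The polynomial associated to the length function `f` (with value `0` if there is none). -/
def hilbertPolynomial (f : ℕ → ℕ∞) : Polynomial ℚ :=
  if h : ∃ P, IsHilbertPolynomial f P then h.choose else 0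

/-- The polynomial `binom (X + m) m = (X + 1) (X + 2) ⋯ (X + m) / m!`. -/
def binomialPolynomial (m : ℕ) : Polynomial ℚ :=
  Polynomial.C ((m.factorial : ℚ)⁻¹) *
    ∏ j ∈ Finset.range m, (Polynomial.X + Polynomial.C ((j : ℚ) + 1))

theorem degree_binomialPolynomial (m : ℕ) : (binomialPolynomial m).degree = m := by
  rw [binomialPolynomial, Polynomial.degree_C_mul (by positivity), Polynomial.degree_prod]
  simp only [Polynomial.degree_X_add_C]
  simp

/-- `e` is the sequence of Hilbert coefficients of the polynomial `P` of degree `d`: the `e i` are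
the integers with `P = ∑_{i = 0}^{d} (-1) ^ i * e i * binom (X + d - i) (d - i)`
(and `e i = 0` for `i > d`). -/
def IsHilbertCoeff (P : Polynomial ℚ) (e : ℕ → ℤ) : Prop :=
  P = ∑ i ∈ Finset.range (P.natDegree + 1),
      Polynomial.C ((-1 : ℚ) ^ i * (e i : ℚ)) * binomialPolynomial (P.natDegree - i) ∧
    ∀ i, P.natDegree < i → e i = 0

/-- The Hilbert coefficients of a polynomial are unique. -/
theorem IsHilbertCoeff.unique {P : Polynomial ℚ} {e e' : ℕ → ℤ}
    (h : IsHilbertCoeff P e) (h' : IsHilbertCoeff P e') : e = e' := by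
  let b : Polynomial.Sequence ℚ := ⟨binomialPolynomial, degree_binomialPolynomial⟩
  have hb : LinearIndependent ℚ binomialPolynomial := b.linearIndependent
  funext i
  by_cases hi : P.natDegree < i
  · rw [h.2 i hi, h'.2 i hi]
  have hs := h.1.symm.trans h'.1
  rw [← sub_eq_zero, ← Finset.sum_sub_distrib, ← Finset.sum_range_reflect] at hs
  have hs2 : ∑ j ∈ Finset.range (P.natDegree + 1), ((-1 : ℚ) ^ (P.natDegree - j) *
      (e (P.natDegree - j) - e' (P.natDegree - j))) • binomialPolynomial j = 0 := by
    rw [← hs]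
    refine Finset.sum_congr rfl fun j hj => ?_
    have : j ≤ P.natDegree := by simp at hj; omega
    rw [show P.natDegree + 1 - 1 - j = P.natDegree - j by omega,
      show P.natDegree - (P.natDegree - j) = j by omega, ← sub_mul, ← Polynomial.C_sub,
      ← Polynomial.smul_eq_C_mul]
    congr 1; ring
  have := linearIndependent_iff'.1 hb _ _ hs2 (P.natDegree - i) (by simp)
  rw [show P.natDegree - (P.natDegree - i) = i by omega] at this
  have h3 : (e i : ℚ) - e' i = 0 := by simpa using this
  exact_mod_cast sub_eq_zero.1 h3

open Classical in
/-- The `i`-th Hilbert coefficient `e_i(P)` (with value `0` if `P` has no expansion with integer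
coefficients). -/
def hilbertCoeff (P : Polynomial ℚ) (i : ℕ) : ℤ :=
  if h : ∃ e, IsHilbertCoeff P e then h.choose i else 0

/-- `P` has degree at least one and has Hilbert coefficients, so that its Chern number `e_1(P)`
is defined. -/
def HasChernNumber (P : Polynomial ℚ) : Prop :=
  1 ≤ P.natDegree ∧ IsHilbertCoeff P (hilbertCoeff P)

variable {R : Type*} [CommRing R]

/-! ### Filtrations of ideals -/

/-- A filtration of ideals of `R`: a decreasing sequence of ideals `B 0 = R ⊇ B 1 ⊇ B 2 ⊇ ⋯`
with `B m * B n ⊆ B (m + n)`. -/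
structure IsIdealFiltration (B : ℕ → Ideal R) : Prop where
  zero : B 0 = ⊤
  antitone : Antitone B
  mul_le : ∀ m n, B m * B n ≤ B (m + n)

/-- Admissibility of `A` over `B`: for some `k` one has `A (n + k) ⊆ B n ⊆ A n` for all `n`. -/
def IsAdmissibleOver (A B : ℕ → Ideal R) : Prop :=
  ∃ k : ℕ, ∀ n, A (n + k) ≤ B n ∧ B n ≤ A n

/-- `A` is `I`-admissible: it is admissible over the `I`-adic filtration. -/
def IsAdmissible (I : Ideal R) (A : ℕ → Ideal R) : Prop :=
  IsAdmissibleOver A (fun n => I ^ n)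

/-- The length function `n ↦ λ (R / B (n + 1))` of a filtration of ideals. -/
def filtrationLength (B : ℕ → Ideal R) (n : ℕ) : ℕ∞ :=
  Module.length R (R ⧸ B (n + 1))

/-- The length function `n ↦ λ (M / I ^ (n + 1) M)`, lengths being taken over `R`. -/
def moduleLength (I : Ideal R) (M : Type*) [AddCommGroup M] [Module R M] (n : ℕ) : ℕ∞ :=
  Module.length R (M ⧸ (I ^ (n + 1) • (⊤ : Submodule R M)))

/-- The Chern number `e_1(B)` of a filtration of ideals. -/
def chernNumber (B : ℕ → Ideal R) : ℤ :=
  hilbertCoeff (hilbertPolynomial (filtrationLength B)) 1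

/-- The Chern number `e_1(I, M)` of `I` with respect to the module `M`. -/
def moduleChernNumber (I : Ideal R) (M : Type*) [AddCommGroup M] [Module R M] : ℤ :=
  hilbertCoeff (hilbertPolynomial (moduleLength I M)) 1

/-! ### Finite covers -/

variable (R) (S : Type*) [CommRing S] [Algebra R S]

/-- `S / R` is a finite cover: a ring extension `R ⊆ S` with `S` a finite `R`-module. -/
structure IsFiniteCover : Prop where
  injective : Function.Injective (algebraMap R S)
  finite : Module.Finite R S

/-- `S / R` is of finite length: the `R`-module `S / R` has finite length. -/
def IsOfFiniteLength : Prop :=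
  Module.length R (S ⧸ LinearMap.range (Algebra.linearMap R S)) ≠ ⊤

/-- `S / R` is birational: `R` is reduced and `S` is, over `R`, contained in the total quotient
ring of `R` (the localization of `R` at its set of nonzerodivisors). -/
def IsBirational : Prop :=
  IsReduced R ∧ ∃ φ : S →ₐ[R] FractionRing R, Function.Injective φ

end ChernNumber

end

open Polynomial Filter

namespace ChernNumber

/-! ### Numerical polynomials -/

/-! Write `P` for the polynomial of `λ(S/I^{n+1}S)` and `Q` for that of `λ(R/B_{n+1})`. The
contraction hypothesis makes `R/B_{n+1}` a quotient of a submodule of `S/I^{n+1}S`, so `Q(n) ≤ P(n)`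
for large `n`. In the other direction `P(n - k) ≤ Q(n) + c` for constants `k` and `c`
(`exists_length_quotient_le_add`): if `S/R` has finite length, that length serves as `c`; if `S` is
birational, a common denominator embeds `S` into `R`, and Artin–Rees costs only a shift.
Admissibility passes from `I^n` to `B` at the cost of a further shift.

Hence `0 ≤ P - Q ≤ P(X) - P(X - k) + c` at large integers, so `P - Q` has degree below that of `P`.
Thus `P` and `Q` have the same degree `r` and the same `e_0`, and the coefficient of `X^{r-1}` in `P
- Q` is a positive multiple of `e_1(Q) - e_1(P)`. It is nonnegative because `P - Q` is
(`hilbertCoeff_one_le`).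

The polynomials exist by the Hilbert–Serre induction (`isEventuallyNumerical_intLength`), applied to
the associated graded module of a stable filtration. -/

/-- The integer combinations of the polynomials `binom (X + m) m`. -/
noncomputable def numericalPolynomials : Submodule ℤ ℚ[X] :=
  Submodule.span ℤ (Set.range binomialPolynomial)

theorem binomialPolynomial_mem (m : ℕ) : binomialPolynomial m ∈ numericalPolynomials :=
  Submodule.subset_span ⟨m, rfl⟩

theorem binomialPolynomial_zero : binomialPolynomial 0 = 1 := by
  simp [binomialPolynomial]

theorem binomialPolynomial_succ_comp (m : ℕ) :
    (binomialPolynomial (m + 1)).comp (X - 1) =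
      binomialPolynomial (m + 1) - binomialPolynomial m := by
  have h1 : (∏ j ∈ Finset.range (m + 1), ((X : ℚ[X]) + C ((j : ℚ) + 1))).comp (X - 1) =
      (∏ j ∈ Finset.range m, ((X : ℚ[X]) + C ((j : ℚ) + 1))) * X := by
    rw [Polynomial.prod_comp, Finset.prod_range_succ']
    congr 1
    · refine Finset.prod_congr rfl fun j _ => ?_
      simp
    · simp
  have h2 : C (((m + 1).factorial : ℚ)⁻¹) * ((m : ℚ[X]) + 1) = C ((m.factorial : ℚ)⁻¹) := by
    have h : ((m + 1).factorial : ℚ)⁻¹ * (m + 1) = (m.factorial : ℚ)⁻¹ := by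
      rw [Nat.factorial_succ]
      push_cast
      field_simp
    rw [← h]
    simp
  rw [binomialPolynomial, binomialPolynomial, mul_comp, h1, C_comp, Finset.prod_range_succ, ← h2]
  simp
  ring

theorem exists_antidifference {P : ℚ[X]} (hP : P ∈ numericalPolynomials) :
    ∃ Q ∈ numericalPolynomials, ∀ x : ℚ, Q.eval (x + 1) - Q.eval x = P.eval x := by
  induction hP using Submodule.span_induction with
  | mem P h =>
    obtain ⟨m, rfl⟩ := h
    -- By Pascal's rule this is `binomialPolynomial (m + 1)` shifted by `-1`, which turns its
    -- backward difference into a forward one.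
    refine ⟨binomialPolynomial (m + 1) - binomialPolynomial m,
      sub_mem (binomialPolynomial_mem _) (binomialPolynomial_mem _), fun x => ?_⟩
    have h1 := congrArg (eval x) (binomialPolynomial_succ_comp m)
    rw [← binomialPolynomial_succ_comp]
    simp only [eval_comp, eval_sub, eval_X, eval_one, add_sub_cancel_right] at h1 ⊢
    linarith
  | zero => exact ⟨0, zero_mem _, by simp⟩
  | add P P' _ _ h h' =>
    obtain ⟨Q, hQ, h⟩ := h
    obtain ⟨Q', hQ', h'⟩ := h'
    refine ⟨Q + Q', add_mem hQ hQ', fun x => ?_⟩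
    simp only [eval_add]
    linarith [h x, h' x]
  | smul a P _ h =>
    obtain ⟨Q, hQ, h⟩ := h
    refine ⟨a • Q, Submodule.smul_mem _ a hQ, fun x => ?_⟩
    simp only [eval_smul, ← h x, smul_sub]

/-- The function `f` agrees with an integer combination of the `binom (n + m) m` for large `n`. -/
def IsEventuallyNumerical (f : ℕ → ℤ) : Prop :=
  ∃ P ∈ numericalPolynomials, ∀ᶠ n : ℕ in atTop, P.eval (n : ℚ) = f n

theorem IsEventuallyNumerical.congr {f g : ℕ → ℤ} (hf : IsEventuallyNumerical f)
    (h : ∀ᶠ n in atTop, f n = g n) : IsEventuallyNumerical g := by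
  obtain ⟨P, hP, hf⟩ := hf
  refine ⟨P, hP, ?_⟩
  filter_upwards [hf, h] with n h1 h2
  rw [h1, h2]

theorem IsEventuallyNumerical.sub {f g : ℕ → ℤ} (hf : IsEventuallyNumerical f)
    (hg : IsEventuallyNumerical g) : IsEventuallyNumerical fun n => f n - g n := by
  obtain ⟨P, hP, hf⟩ := hf
  obtain ⟨Q, hQ, hg⟩ := hg
  refine ⟨P - Q, sub_mem hP hQ, ?_⟩
  filter_upwards [hf, hg] with n h1 h2
  simp [h1, h2]

/-- From some point on, `f` differs from an antidifference by a constant. That constant is an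
integer because numerical polynomials take integer values at naturals. -/
theorem IsEventuallyNumerical.of_difference {f : ℕ → ℤ}
    (h : IsEventuallyNumerical fun n => f (n + 1) - f n) : IsEventuallyNumerical f := by
  obtain ⟨P, hP, hf⟩ := h
  obtain ⟨Q, hQ, hQP⟩ := exists_antidifference hP
  obtain ⟨N, hN⟩ := eventually_atTop.1 hf
  have hint : ∀ P ∈ numericalPolynomials, ∀ n : ℕ, ∃ a : ℤ, P.eval (n : ℚ) = a := by
    intro P hP n
    induction hP using Submodule.span_induction with
    | mem P h =>
      obtain ⟨m, rfl⟩ := h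
      refine ⟨(n + m).choose m, ?_⟩
      have hprod : ∏ j ∈ Finset.range m, ((n : ℚ) + (j + 1)) = (n + 1).ascFactorial m := by
        rw [Nat.ascFactorial_eq_prod_range]
        push_cast
        exact Finset.prod_congr rfl fun j _ => by ring
      rw [binomialPolynomial, eval_C_mul, eval_prod]
      simp only [eval_add, eval_X, eval_C]
      rw [hprod, Nat.ascFactorial_eq_factorial_mul_choose]
      push_cast
      field_simp
    | zero => exact ⟨0, by simp⟩
    | add P P' _ _ h h' =>
      obtain ⟨a, ha⟩ := h
      obtain ⟨b, hb⟩ := h'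
      exact ⟨a + b, by simp [ha, hb]⟩
    | smul c P _ h =>
      obtain ⟨a, ha⟩ := h
      exact ⟨c * a, by simp [ha]⟩
  obtain ⟨a, ha⟩ := hint Q hQ N
  refine ⟨Q + (f N - a) • binomialPolynomial 0,
    add_mem hQ (Submodule.smul_mem _ _ (binomialPolynomial_mem 0)), ?_⟩
  refine eventually_atTop.2 ⟨N, fun n hn => ?_⟩
  induction n, hn using Nat.le_induction with
  | base => simp [ha, binomialPolynomial_zero]
  | succ n hn ih =>
    have h1 := hN n hn
    have h2 := hQP n
    simp only [eval_add, binomialPolynomial_zero, eval_smul, eval_one] at ih ⊢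
    push_cast at h1 ⊢
    linarith

theorem exists_isHilbertCoeff {P : ℚ[X]} (hP : P ∈ numericalPolynomials) :
    ∃ e, IsHilbertCoeff P e := by
  have h1 : ∃ (N : ℕ) (a : ℕ → ℤ),
      P = ∑ j ∈ Finset.range N, C (a j : ℚ) * binomialPolynomial j := by
    obtain ⟨c, hc⟩ := (Finsupp.mem_span_range_iff_exists_finsupp).1 hP
    refine ⟨c.support.sup id + 1, c, ?_⟩
    rw [← hc, Finsupp.sum]
    refine (Finset.sum_congr rfl fun j _ => ?_).trans (Finset.sum_subset ?_ ?_)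
    · rw [← smul_eq_C_mul, Int.cast_smul_eq_zsmul]
    · intro j hj
      exact Finset.mem_range.2 (Nat.lt_succ_of_le (Finset.le_sup (f := id) hj))
    · intro j _ hj
      simp [Finsupp.notMem_support_iff.1 hj]
  obtain ⟨N, a, h⟩ := h1
  have h2 : ∃ a : ℕ → ℤ,
      P = ∑ j ∈ Finset.range (P.natDegree + 1), C (a j : ℚ) * binomialPolynomial j := by
    clear hP
    induction N with
    | zero =>
      have : P = 0 := by simpa using h
      exact ⟨0, by simp [this]⟩
    | succ N ih =>
      -- Terms above the degree of `P` are stripped one at a time: `binomialPolynomial N` has degree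
      -- exactly `N`, so its coefficient must vanish.
      rcases lt_trichotomy P.natDegree N with hN | hN | hN
      · refine ih ?_
        have hc := congrArg (fun p => coeff p N) h
        simp only [coeff_eq_zero_of_natDegree_lt hN, finsetSum_coeff, coeff_C_mul] at hc
        rw [Finset.sum_range_succ, Finset.sum_eq_zero, zero_add] at hc
        · have hb : (binomialPolynomial N).coeff N ≠ 0 :=
            coeff_ne_zero_of_eq_degree (degree_binomialPolynomial N)
          have ha : (a N : ℚ) = 0 := by
            rcases mul_eq_zero.1 hc.symm with h0 | h0
            · exact h0
            · exact absurd h0 hb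
          rw [h, Finset.sum_range_succ, ha]
          simp
        · intro j hj
          rw [coeff_eq_zero_of_degree_lt, mul_zero]
          rw [degree_binomialPolynomial]
          exact_mod_cast Finset.mem_range.1 hj
      · exact ⟨a, by rw [hN]; exact h⟩
      · refine absurd hN (not_lt.2 ?_)
        rw [h]
        refine natDegree_sum_le_of_forall_le _ _ fun j hj => ?_
        refine (natDegree_C_mul_le _ _).trans ?_
        rw [natDegree_eq_of_degree_eq_some (degree_binomialPolynomial j)]
        exact Nat.lt_succ_iff.1 (Finset.mem_range.1 hj)
  obtain ⟨a, h⟩ := h2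
  refine ⟨fun i => if P.natDegree < i then 0 else (-1) ^ i * a (P.natDegree - i), ?_, ?_⟩
  · conv_lhs => rw [h, ← Finset.sum_range_reflect]
    refine Finset.sum_congr rfl fun i hi => ?_
    have hi' : ¬ P.natDegree < i := by simp at hi; omega
    simp only [if_neg hi']
    rw [show P.natDegree + 1 - 1 - i = P.natDegree - i by omega]
    congr 2
    push_cast
    rw [← mul_assoc, ← mul_pow]
    simp
  · intro i hi
    simp [hi]

theorem isHilbertCoeff_hilbertCoeff {P : ℚ[X]} (hP : P ∈ numericalPolynomials) :
    IsHilbertCoeff P (hilbertCoeff P) := by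
  have h := exists_isHilbertCoeff hP
  have he : hilbertCoeff P = h.choose := by
    funext i
    simp [hilbertCoeff, h]
  rw [he]
  exact h.choose_spec

theorem hilbertPolynomial_eq {f : ℕ → ℕ∞} {P : ℚ[X]} (h : IsHilbertPolynomial f P) :
    hilbertPolynomial f = P := by
  have he : ∃ P, IsHilbertPolynomial f P := ⟨P, h⟩
  rw [hilbertPolynomial, dif_pos he]
  exact he.choose_spec.unique h

/-! ### Comparison of numerical polynomials -/

theorem coeff_nonneg_of_eventually_nonneg {P : ℚ[X]} {r : ℕ} (hr : P.natDegree ≤ r)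
    (h : ∀ᶠ n : ℕ in atTop, 0 ≤ P.eval (n : ℚ)) : 0 ≤ P.coeff r := by
  by_contra! hneg
  have hdeg : P.natDegree = r := le_antisymm hr (le_natDegree_of_ne_zero hneg.ne)
  have hlc : P.leadingCoeff < 0 := by rwa [leadingCoeff, hdeg]
  rcases Nat.eq_zero_or_pos r with h0 | h0
  · have hC := eq_C_of_natDegree_eq_zero (hdeg.trans h0)
    obtain ⟨n, hn⟩ := h.exists
    rw [hC, eval_C, ← h0] at hn
    linarith
  · have ht := (tendsto_atBot_of_leadingCoeff_nonpos P
      (natDegree_pos_iff_degree_pos.1 (hdeg ▸ h0)) hlc.le).comp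
        (tendsto_natCast_atTop_atTop (R := ℚ))
    obtain ⟨n, hn, hn'⟩ := (h.and (ht.eventually (eventually_lt_atBot 0))).exists
    exact absurd hn (not_le.2 hn')

theorem natDegree_le_of_eventually_abs_le {P D : ℚ[X]}
    (h0 : ∀ᶠ n : ℕ in atTop, 0 ≤ P.eval (n : ℚ))
    (h : ∀ᶠ n : ℕ in atTop, P.eval (n : ℚ) ≤ D.eval (n : ℚ)) :
    P.natDegree ≤ D.natDegree := by
  by_contra! hlt
  have h1 := coeff_nonneg_of_eventually_nonneg le_rfl h0
  have h2 := coeff_nonneg_of_eventually_nonneg (P := D - P) (r := P.natDegree)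
    ((natDegree_sub_le _ _).trans (max_le hlt.le le_rfl)) (by
      filter_upwards [h] with n hn
      simpa using hn)
  rw [coeff_sub, coeff_eq_zero_of_natDegree_lt hlt] at h2
  have h3 : P.leadingCoeff = 0 := le_antisymm (by rw [leadingCoeff]; linarith) h1
  rw [leadingCoeff_eq_zero.1 h3] at hlt
  simp at hlt

/-- A translate has the same leading term, which cancels. For constant `P` the difference is zero,
consistent with truncated `0 - 1 = 0`. -/
theorem natDegree_sub_comp_le (P : ℚ[X]) (c : ℚ) :
    (P - P.comp (X - C c)).natDegree ≤ P.natDegree - 1 := by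
  rcases Nat.eq_zero_or_pos P.natDegree with h | h
  · rw [eq_C_of_natDegree_eq_zero h]
    simp
  · have hP : P ≠ 0 := by rintro rfl; simp at h
    have hd : (P.comp (X - C c)).natDegree = P.natDegree := by
      rw [natDegree_comp, natDegree_X_sub_C, mul_one]
    have hl : (P.comp (X - C c)).leadingCoeff = P.leadingCoeff := by
      rw [leadingCoeff_comp (by simp), (monic_X_sub_C c).leadingCoeff]
      simp
    have hc0 : P.comp (X - C c) ≠ 0 := by
      intro h0
      rw [h0] at hd
      simp at hd
      omega
    have := degree_sub_lt_left (p := P) (q := P.comp (X - C c))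
      (by rw [degree_eq_natDegree hP, degree_eq_natDegree hc0, hd]) hP hl.symm
    rcases eq_or_ne (P - P.comp (X - C c)) 0 with h0 | h0
    · simp [h0]
    · have := natDegree_lt_natDegree h0 this
      omega

/-- The two estimates squeeze `P - Q` between zero and a polynomial of degree at most `deg P - 1`.
The degrees and `e_0` then agree, and the next coefficient compares `e_1` with reversed sign. -/
theorem hilbertCoeff_one_le {P Q : ℚ[X]} (hP : P ∈ numericalPolynomials)
    (hQ : Q ∈ numericalPolynomials) (hdeg : 1 ≤ Q.natDegree)
    (hQP : ∀ᶠ n : ℕ in atTop, Q.eval (n : ℚ) ≤ P.eval (n : ℚ)) (k c : ℕ)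
    (hPQ : ∀ᶠ n : ℕ in atTop, P.eval ((n : ℚ) - k) ≤ Q.eval (n : ℚ) + c) :
    1 ≤ P.natDegree ∧ hilbertCoeff P 1 ≤ hilbertCoeff Q 1 := by
  have h1 : (P - Q).natDegree ≤ P.natDegree - 1 := by
    refine (natDegree_le_of_eventually_abs_le (D := P - P.comp (X - C (k : ℚ)) + C (c : ℚ))
      ?_ ?_).trans ?_
    · filter_upwards [hQP] with n hn
      simpa using hn
    · filter_upwards [hPQ] with n hn
      simp only [eval_sub, eval_add, eval_comp, eval_X, eval_C]
      linarith
    · refine (natDegree_add_C).le.trans (natDegree_sub_comp_le _ _)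
  -- If `P` were constant, so would be `P - Q`, and hence `Q`.
  have hPdeg : 1 ≤ P.natDegree := by
    by_contra! h
    have h2 := natDegree_sub_le_of_le (p := P) (q := P - Q) (m := 0) (n := 0)
      (by omega) (by omega)
    rw [sub_sub_cancel] at h2
    simp at h2
    omega
  have hd : Q.natDegree = P.natDegree := by
    have h2 := natDegree_sub_eq_left_of_natDegree_lt (p := P) (q := P - Q) (by omega)
    rwa [sub_sub_cancel] at h2
  refine ⟨hPdeg, ?_⟩
  obtain ⟨r, hr⟩ : ∃ r, P.natDegree = r + 1 := ⟨P.natDegree - 1, by omega⟩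
  have hnn := coeff_nonneg_of_eventually_nonneg (P := P - Q) (r := r) (by omega) (by
    filter_upwards [hQP] with n hn
    simpa using hn)
  have hb : 0 < (binomialPolynomial r).coeff r := by
    have hl : (binomialPolynomial r).leadingCoeff = (r.factorial : ℚ)⁻¹ := by
      rw [binomialPolynomial, leadingCoeff_mul, leadingCoeff_prod]
      simp only [leadingCoeff_X_add_C, leadingCoeff_C]
      simp
    rw [leadingCoeff, natDegree_eq_of_degree_eq_some (degree_binomialPolynomial r)] at hl
    rw [hl]
    positivity
  have hb1 : (binomialPolynomial (r + 1)).coeff (r + 1) ≠ 0 :=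
    coeff_ne_zero_of_eq_degree (degree_binomialPolynomial (r + 1))
  have hlow : ∀ m j, m < j → (binomialPolynomial m).coeff j = 0 := fun m j h =>
    coeff_eq_zero_of_degree_lt (by rw [degree_binomialPolynomial]; exact_mod_cast h)
  -- Only the terms `i = 0, 1` of the expansion reach degree `r`.
  have expand : ∀ F : ℚ[X], F ∈ numericalPolynomials → F.natDegree = r + 1 →
      F.coeff (r + 1) = hilbertCoeff F 0 * (binomialPolynomial (r + 1)).coeff (r + 1) ∧
      F.coeff r = hilbertCoeff F 0 * (binomialPolynomial (r + 1)).coeff r -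
        hilbertCoeff F 1 * (binomialPolynomial r).coeff r := by
    intro F hF hFd
    have h := (isHilbertCoeff_hilbertCoeff hF).1
    rw [hFd, Finset.sum_range_succ', Finset.sum_range_succ'] at h
    constructor
    · have hc := congrArg (fun p => coeff p (r + 1)) h
      simp only [coeff_add, finsetSum_coeff, coeff_C_mul] at hc
      rw [hc, Finset.sum_eq_zero, hlow (r + 1 - (0 + 1)) _ (by omega)]
      · simp
      · intro i _
        rw [hlow _ _ (by omega), mul_zero]
    · have hc := congrArg (fun p => coeff p r) h
      simp only [coeff_add, finsetSum_coeff, coeff_C_mul] at hc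
      rw [hc, Finset.sum_eq_zero]
      · simp
        ring
      · intro i hi
        rw [Finset.mem_range] at hi
        rw [hlow _ _ (by omega), mul_zero]
  obtain ⟨hP0, hP1⟩ := expand P hP hr
  obtain ⟨hQ0, hQ1⟩ := expand Q hQ (hd.trans hr)
  have htop : (P - Q).coeff (r + 1) = 0 := coeff_eq_zero_of_natDegree_lt (by omega)
  rw [coeff_sub, hP0, hQ0, ← sub_mul] at htop
  have he : (hilbertCoeff P 0 : ℚ) = hilbertCoeff Q 0 :=
    sub_eq_zero.1 ((mul_eq_zero.1 htop).resolve_right hb1)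
  rw [coeff_sub, hP1, hQ1, he] at hnn
  have hfin : 0 ≤ ((hilbertCoeff Q 1 : ℚ) - hilbertCoeff P 1) * (binomialPolynomial r).coeff r := by
    linarith
  have := nonneg_of_mul_nonneg_left hfin hb
  exact_mod_cast sub_nonneg.1 this

/-! ### Lengths of graded modules -/

section Graded

universe u v

variable {R : Type v} [CommRing R]

/-- The graded submodules of a graded module `M 0, M 1, ⋯` on which finitely many operators
`x i` of degree one act. -/
def GradedSubmodule {s : ℕ} (M : ℕ → Type u) [∀ n, AddCommGroup (M n)] [∀ n, Module R (M n)]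
    (x : Fin s → ∀ n, M n →ₗ[R] M (n + 1)) : Type u :=
  {N : ∀ n, Submodule R (M n) // ∀ i n, N n ≤ (N (n + 1)).comap (x i n)}

instance {s : ℕ} (M : ℕ → Type u) [∀ n, AddCommGroup (M n)] [∀ n, Module R (M n)]
    (x : Fin s → ∀ n, M n →ₗ[R] M (n + 1)) : PartialOrder (GradedSubmodule M x) :=
  inferInstanceAs (PartialOrder {_N : ∀ n, Submodule R (M n) // _})

/-- The length of a module as an integer (zero if the length is infinite). -/
noncomputable def intLength (R : Type v) [CommRing R] (M : Type u) [AddCommGroup M]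
    [Module R M] : ℤ :=
  ((Module.length R M).toNat : ℤ)

theorem intLength_eq_add {M N P : Type*} [AddCommGroup M] [Module R M] [AddCommGroup N]
    [Module R N] [AddCommGroup P] [Module R P] (f : N →ₗ[R] M) (g : M →ₗ[R] P)
    (hf : Function.Injective f) (hg : Function.Surjective g) (H : Function.Exact f g)
    (hM : Module.length R M ≠ ⊤) : intLength R M = intLength R N + intLength R P := by
  have h := Module.length_eq_add_of_exact f g hf hg H
  have hN : Module.length R N ≠ ⊤ := ne_top_of_le_ne_top hM (h ▸ le_self_add)
  have hP : Module.length R P ≠ ⊤ := ne_top_of_le_ne_top hM (h ▸ le_add_self)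
  rw [intLength, intLength, intLength, h, ENat.toNat_add hN hP]
  push_cast
  rfl

theorem intLength_sub_eq {M N : Type*} [AddCommGroup M] [Module R M] [AddCommGroup N]
    [Module R N] (f : M →ₗ[R] N) (hM : Module.length R M ≠ ⊤) (hN : Module.length R N ≠ ⊤) :
    intLength R N - intLength R M =
      intLength R (N ⧸ LinearMap.range f) - intLength R (LinearMap.ker f) := by
  have h1 := intLength_eq_add (LinearMap.ker f).subtype f.rangeRestrict
    (Submodule.subtype_injective _) f.surjective_rangeRestrict (by
      intro y
      simp [← LinearMap.mem_ker]) hM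
  have h2 := intLength_eq_add (LinearMap.range f).subtype (LinearMap.range f).mkQ
    (Submodule.subtype_injective _) (Submodule.mkQ_surjective _)
    (LinearMap.exact_subtype_mkQ _) hN
  linarith

/-- Hilbert–Serre induction on the number of operators: the kernel and cokernel of `x 0` carry only
the remaining ones, and their lengths determine the first difference. Noetherianity is stated as the
ascending chain condition on graded submodules, so no graded ring is needed. -/
theorem isEventuallyNumerical_intLength {s : ℕ} :
    ∀ (M : ℕ → Type u) [∀ n, AddCommGroup (M n)] [∀ n, Module R (M n)]
      (x : Fin s → ∀ n, M n →ₗ[R] M (n + 1))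
      (_ : ∀ i j n y, x i (n + 1) (x j n y) = x j (n + 1) (x i n y))
      (_ : WellFoundedGT (GradedSubmodule M x))
      (_ : ∀ n, Module.length R (M n) ≠ ⊤),
      IsEventuallyNumerical fun n => intLength R (M n) := by
  induction s with
  | zero =>
    intro M _ _ x _ hN _
    -- Without operators any family is graded. The truncations of `M` stabilize, so `M n = 0` for
    -- large `n`.
    let T : ℕ →o GradedSubmodule M x :=
      ⟨fun k => ⟨fun n => if n < k then ⊤ else ⊥, fun i => i.elim0⟩, by
        intro a b hab n
        by_cases h : n < a
        · simp [h, h.trans_le hab]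
        · simp [h]⟩
    obtain ⟨k, hk⟩ := WellFoundedGT.monotone_chain_condition T
    refine ⟨0, zero_mem _, eventually_atTop.2 ⟨k, fun n hn => ?_⟩⟩
    have h1 : (T k).1 n = (T (n + 1)).1 n := by rw [hk (n + 1) (by omega)]
    have h2 : (if n < k then (⊤ : Submodule R (M n)) else ⊥) = if n < n + 1 then ⊤ else ⊥ := h1
    rw [if_neg (not_lt.2 hn), if_pos (Nat.lt_succ_self n)] at h2
    have : Subsingleton (M n) := (Submodule.subsingleton_iff R).1 (subsingleton_of_bot_eq_top h2)
    simp [intLength, Module.length_eq_zero]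
  | succ s ih =>
    intro M _ _ x hx hN hfin
    have hK : IsEventuallyNumerical fun n => intLength R (LinearMap.ker (x 0 n)) := by
      let xK : Fin s → ∀ n, LinearMap.ker (x 0 n) →ₗ[R] LinearMap.ker (x 0 (n + 1)) :=
        fun i n => (x i.succ n).restrict (fun y hy => by
          rw [LinearMap.mem_ker] at hy ⊢
          rw [hx, hy, map_zero])
      refine ih (fun n => LinearMap.ker (x 0 n)) xK ?_ ?_ ?_
      · intro i j n y
        exact Subtype.ext (hx _ _ _ _)
      · let Φ : GradedSubmodule (fun n => LinearMap.ker (x 0 n)) xK → GradedSubmodule M x :=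
          fun N => ⟨fun n => (N.1 n).map (LinearMap.ker (x 0 n)).subtype, by
            intro i n
            rintro _ ⟨y, hy, rfl⟩
            refine Fin.cases ?_ (fun i => ?_) i
            · have : x 0 n y = 0 := y.2
              simp [this]
            · exact ⟨xK i n y, N.2 i n hy, rfl⟩⟩
        have hΦ : StrictMono Φ := by
          refine Monotone.strictMono_of_injective (fun N N' h n => Submodule.map_mono (h n)) ?_
          intro N N' h
          refine Subtype.ext (funext fun n => ?_)
          have h' : (Φ N).1 n = (Φ N').1 n := by rw [h]
          exact Submodule.map_injective_of_injective (Submodule.subtype_injective _) h'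
        exact hΦ.wellFoundedGT
      · intro n
        exact ne_top_of_le_ne_top (hfin n)
          (Module.length_le_of_injective _ (Submodule.subtype_injective _))
    have hL : IsEventuallyNumerical fun n => intLength R (M (n + 1) ⧸ LinearMap.range (x 0 n)) := by
      have hle : ∀ (i : Fin s) n, LinearMap.range (x 0 n) ≤
          (LinearMap.range (x 0 (n + 1))).comap (x i.succ (n + 1)) := by
        rintro i n _ ⟨y, rfl⟩
        exact ⟨x i.succ n y, hx _ _ _ _⟩
      let xL : Fin s → ∀ n, (M (n + 1) ⧸ LinearMap.range (x 0 n)) →ₗ[R]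
          (M (n + 1 + 1) ⧸ LinearMap.range (x 0 (n + 1))) :=
        fun i n => Submodule.mapQ _ _ (x i.succ (n + 1)) (hle i n)
      refine ih (fun n => M (n + 1) ⧸ LinearMap.range (x 0 n)) xL ?_ ?_ ?_
      · intro i j n y
        obtain ⟨y, rfl⟩ := Submodule.mkQ_surjective _ y
        simp only [xL, Submodule.mkQ_apply, Submodule.mapQ_apply]
        rw [hx]
      · let Ψ : GradedSubmodule (fun n => M (n + 1) ⧸ LinearMap.range (x 0 n)) xL →
            ∀ n, Submodule R (M n) := fun N n => match n with
          | 0 => ⊥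
          | n + 1 => (N.1 n).comap (LinearMap.range (x 0 n)).mkQ
        let Φ : GradedSubmodule (fun n => M (n + 1) ⧸ LinearMap.range (x 0 n)) xL →
            GradedSubmodule M x :=
          fun N => ⟨Ψ N, by
            intro i n
            match n with
            | 0 => exact bot_le
            | n + 1 =>
              intro y hy
              refine Fin.cases ?_ (fun i => ?_) i
              · have h0 : (LinearMap.range (x 0 (n + 1))).mkQ (x 0 (n + 1) y) = 0 :=
                  (Submodule.Quotient.mk_eq_zero _).2 (LinearMap.mem_range_self _ _)
                change (LinearMap.range (x 0 (n + 1))).mkQ (x 0 (n + 1) y) ∈ N.1 (n + 1)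
                rw [h0]
                exact zero_mem _
              · exact N.2 i n hy⟩
        have hΦ : StrictMono Φ := by
          refine Monotone.strictMono_of_injective (fun N N' h n => ?_) ?_
          · match n with
            | 0 => exact le_rfl
            | n + 1 => exact Submodule.comap_mono (h n)
          · intro N N' h
            refine Subtype.ext (funext fun n => ?_)
            have h' : (Φ N).1 (n + 1) = (Φ N').1 (n + 1) := by rw [h]
            exact Submodule.comap_injective_of_surjective (Submodule.mkQ_surjective _) h'
        exact hΦ.wellFoundedGT
      · intro n
        exact ne_top_of_le_ne_top (hfin (n + 1))
          (Module.length_le_of_surjective _ (Submodule.mkQ_surjective _))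
    refine .of_difference ((hL.sub hK).congr (Eventually.of_forall fun n => ?_))
    exact (intLength_sub_eq (x 0 n) (hfin n) (hfin (n + 1))).symm

end Graded

/-! ### Hilbert polynomials of stable filtrations -/

section Stable

universe u v

variable {R : Type v} [CommRing R] {M : Type u} [AddCommGroup M] [Module R M] {I : Ideal R}

theorem submodule_injective : Function.Injective (Ideal.Filtration.submodule :
    I.Filtration M → Submodule (reesAlgebra I) (PolynomialModule R M)) := by
  have key : ∀ F F' : I.Filtration M, F.submodule = F'.submodule → F ≤ F' := by
    intro F F' h n m hm
    have h1 : PolynomialModule.single R n m ∈ F.submodule := by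
      intro i
      rcases eq_or_ne n i with rfl | hi
      · simpa using hm
      · have : (PolynomialModule.single R n m).coeff i = 0 := by
          rw [PolynomialModule.coeff_single]
          exact Finsupp.single_eq_of_ne hi.symm
        rw [this]
        exact zero_mem _
    rw [h] at h1
    simpa using h1 n
  intro F F' h
  exact le_antisymm (key F F' h) (key F' F h.symm)

/-- Stability makes the Rees module of `F` finitely generated over the Noetherian Rees algebra, and
subfiltrations of `F` embed into its lattice of submodules. -/
theorem wellFoundedGT_of_stable [IsNoetherianRing R] [Module.Finite R M]
    {F : I.Filtration M} (hF : F.Stable) : WellFoundedGT {F' : I.Filtration M // F' ≤ F} := by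
  rw [← Ideal.Filtration.submodule_fg_iff_stable _ fun i => IsNoetherian.noetherian _] at hF
  have := isNoetherian_of_fg_of_noetherian _ hF
  let Φ : {F' : I.Filtration M // F' ≤ F} → Submodule (reesAlgebra I) F.submodule :=
    fun F' => F'.1.submodule.comap F.submodule.subtype
  have hle : ∀ F' : {F' : I.Filtration M // F' ≤ F}, F'.1.submodule ≤ F.submodule :=
    fun F' f hf i => F'.2 i (hf i)
  have hΦ : StrictMono Φ := by
    refine Monotone.strictMono_of_injective
      (fun F₁ F₂ h => Submodule.comap_mono fun f hf i => h i (hf i)) ?_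
    intro F₁ F₂ h
    refine Subtype.ext (submodule_injective ?_)
    have h' := congrArg (Submodule.map F.submodule.subtype) h
    simp only [Φ, Submodule.map_comap_subtype] at h'
    rwa [inf_eq_right.2 (hle F₁), inf_eq_right.2 (hle F₂)] at h'
  exact hΦ.wellFoundedGT

/-- The length function of a stable filtration is eventually a numerical polynomial. -/
theorem isEventuallyNumerical_of_stable [IsNoetherianRing R] [Module.Finite R M]
    {F : I.Filtration M} (hF : F.Stable) (hfin : ∀ n, Module.length R (M ⧸ F.N n) ≠ ⊤) :
    IsEventuallyNumerical fun n => intLength R (M ⧸ F.N n) := by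
  obtain ⟨s, a, ha⟩ := Submodule.fg_iff_exists_fin_generating_family.1
    (IsNoetherian.noetherian I)
  have haI : ∀ i, a i ∈ I := fun i => ha ▸ Submodule.subset_span ⟨i, rfl⟩
  -- The associated graded module, with generators of `I` acting by multiplication.
  let G : ℕ → Type u := fun n => F.N n ⧸ (F.N (n + 1)).comap (F.N n).subtype
  let y : Fin s → ∀ n, F.N n →ₗ[R] F.N (n + 1) := fun i n =>
    (LinearMap.lsmul R M (a i)).restrict fun m hm =>
      F.smul_le n (Submodule.smul_mem_smul (haI i) hm)
  have hy : ∀ i n, (F.N (n + 1)).comap (F.N n).subtype ≤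
      ((F.N (n + 1 + 1)).comap (F.N (n + 1)).subtype).comap (y i n) := fun i n m hm =>
    F.smul_le (n + 1) (Submodule.smul_mem_smul (haI i) hm)
  let x : Fin s → ∀ n, G n →ₗ[R] G (n + 1) := fun i n => Submodule.mapQ _ _ (y i n) (hy i n)
  have hG : IsEventuallyNumerical fun n => intLength R (G n) := by
    refine isEventuallyNumerical_intLength G x ?_ ?_ ?_
    · intro i j n m
      obtain ⟨m, rfl⟩ := Submodule.mkQ_surjective _ m
      change Submodule.mkQ _ (y i (n + 1) (y j n m)) = Submodule.mkQ _ (y j (n + 1) (y i n m))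
      exact congrArg _ (Subtype.ext (smul_comm (a i) (a j) (m : M)))
    -- The preimage of `N n` lies between `F.N (n + 1)` and `F.N n`, so these preimages decrease and
    -- form a subfiltration of `F`.
    · let T : GradedSubmodule G x → ∀ n, Submodule R M := fun N n =>
        ((N.1 n).comap (Submodule.mkQ _)).map (F.N n).subtype
      have hle : ∀ N n, T N n ≤ F.N n := fun N n => Submodule.map_subtype_le _ _
      have hge : ∀ N n, F.N (n + 1) ≤ T N n := by
        intro N n m hm
        refine ⟨⟨m, F.mono n hm⟩, ?_, rfl⟩
        have h0 : ((F.N (n + 1)).comap (F.N n).subtype).mkQ ⟨m, F.mono n hm⟩ = 0 :=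
          (Submodule.Quotient.mk_eq_zero _).2 hm
        change ((F.N (n + 1)).comap (F.N n).subtype).mkQ ⟨m, F.mono n hm⟩ ∈ N.1 n
        rw [h0]
        exact zero_mem _
      let Φ : GradedSubmodule G x → {F' : I.Filtration M // F' ≤ F} := fun N =>
        ⟨{ N := T N
           mono := fun n => (hle N (n + 1)).trans (hge N n)
           smul_le := fun n => by
            rw [← ha, Submodule.span_smul_eq, Submodule.set_smul_le_iff]
            rintro _ m ⟨i, rfl⟩ ⟨m, hm, rfl⟩
            exact ⟨y i n m, N.2 i n hm, rfl⟩ }, hle N⟩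
      have hΦ : StrictMono Φ := by
        refine Monotone.strictMono_of_injective
          (fun N N' h n => Submodule.map_mono (Submodule.comap_mono (h n))) ?_
        intro N N' h
        refine Subtype.ext (funext fun n => ?_)
        have h' : T N n = T N' n := congrArg (fun F' => F'.1.N n) h
        exact Submodule.comap_injective_of_surjective (Submodule.mkQ_surjective _)
          (Submodule.map_injective_of_injective (Submodule.subtype_injective _) h')
      have := wellFoundedGT_of_stable hF
      exact hΦ.wellFoundedGT
    · intro n
      refine ne_top_of_le_ne_top (hfin (n + 1)) (Module.length_le_of_injective
        (Submodule.mapQ _ _ (F.N n).subtype le_rfl) ?_)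
      rw [← LinearMap.ker_eq_bot, Submodule.ker_mapQ]
      simp
  have hdiff : ∀ n, intLength R (M ⧸ F.N (n + 1)) - intLength R (M ⧸ F.N n) =
      intLength R (G n) := by
    intro n
    have := intLength_eq_add (R := R)
      (Submodule.mapQ ((F.N (n + 1)).comap (F.N n).subtype) (F.N (n + 1)) (F.N n).subtype le_rfl)
      (Submodule.factor (F.mono n)) ?_ (Submodule.factor_surjective _) ?_ (hfin (n + 1))
    · linarith
    · rw [← LinearMap.ker_eq_bot, Submodule.ker_mapQ]
      simp
    · rw [LinearMap.exact_iff, Submodule.range_mapQ, Submodule.factor, Submodule.ker_mapQ]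
      simp
  exact .of_difference (hG.congr (Eventually.of_forall fun n => (hdiff n).symm))

/-- The length function of a stable filtration has a Hilbert polynomial, which is numerical. -/
theorem exists_isHilbertPolynomial_of_stable [IsNoetherianRing R] [Module.Finite R M]
    {F : I.Filtration M} (hF : F.Stable) (hfin : ∀ n, Module.length R (M ⧸ F.N n) ≠ ⊤) :
    ∃ P ∈ numericalPolynomials,
      IsHilbertPolynomial (fun n => Module.length R (M ⧸ F.N (n + 1))) P := by
  let F' : I.Filtration M := ⟨fun n => F.N (n + 1), fun n => F.mono _, fun n => F.smul_le _⟩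
  have hF' : F'.Stable := by
    obtain ⟨n₀, h⟩ := hF
    exact ⟨n₀, fun n hn => h (n + 1) (by omega)⟩
  obtain ⟨P, hP, h⟩ := isEventuallyNumerical_of_stable hF' fun n => hfin (n + 1)
  refine ⟨P, hP, ?_⟩
  filter_upwards [h] with n hn
  refine ⟨(Module.length R (M ⧸ F.N (n + 1))).toNat, (ENat.natCast_toNat (hfin _)).symm, ?_⟩
  rw [hn, intLength]
  simp [F']

end Stable

/-! ### Length comparisons along linear maps -/

section Comparison

variable {R : Type*} [CommRing R] {M N : Type*} [AddCommGroup M] [Module R M]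
  [AddCommGroup N] [Module R N]

theorem smul_top_le_comap (J : Ideal R) (f : M →ₗ[R] N) :
    J • (⊤ : Submodule R M) ≤ (J • (⊤ : Submodule R N)).comap f := by
  rw [← Submodule.map_le_iff_le_comap, Submodule.map_smul'']
  exact smul_mono_right _ le_top

theorem length_quotient_le_of_le {K L : Submodule R M} (h : K ≤ L) :
    Module.length R (M ⧸ L) ≤ Module.length R (M ⧸ K) :=
  Module.length_le_of_surjective _ (Submodule.factor_surjective h)

theorem length_quotient_comap_le (f : M →ₗ[R] N) (K : Submodule R N) :
    Module.length R (M ⧸ K.comap f) ≤ Module.length R (N ⧸ K) := by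
  refine Module.length_le_of_injective (Submodule.mapQ _ _ f le_rfl) ?_
  rw [← LinearMap.ker_eq_bot, Submodule.ker_mapQ]
  simp

/-- A consequence of the Artin–Rees lemma. -/
theorem exists_comap_pow_smul_le [IsNoetherianRing R] [Module.Finite R N] (I : Ideal R)
    (f : M →ₗ[R] N) (hf : Function.Injective f) :
    ∃ k : ℕ, ∀ n, (I ^ (n + k) • (⊤ : Submodule R N)).comap f ≤ I ^ n • (⊤ : Submodule R M) := by
  obtain ⟨k, hk⟩ := I.exists_pow_inf_eq_pow_smul (LinearMap.range f)
  refine ⟨k, fun n m hm => ?_⟩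
  have h1 : f m ∈ I ^ (n + k) • (⊤ : Submodule R N) ⊓ LinearMap.range f := ⟨hm, m, rfl⟩
  rw [hk _ (by omega), Nat.add_sub_cancel] at h1
  have h2 : f m ∈ (I ^ n • (⊤ : Submodule R M)).map f := by
    rw [Submodule.map_smul'', Submodule.map_top]
    exact (smul_mono_right _ inf_le_right : _ ≤ I ^ n • LinearMap.range f) h1
  obtain ⟨m', hm', he⟩ := h2
  rwa [← hf he]

theorem exists_length_quotient_le_of_injective [IsNoetherianRing R] [Module.Finite R N]
    (I : Ideal R) (f : M →ₗ[R] N) (hf : Function.Injective f) :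
    ∃ k : ℕ, ∀ n, Module.length R (M ⧸ I ^ n • (⊤ : Submodule R M)) ≤
      Module.length R (N ⧸ I ^ (n + k) • (⊤ : Submodule R N)) := by
  obtain ⟨k, hk⟩ := exists_comap_pow_smul_le I f hf
  exact ⟨k, fun n => (length_quotient_le_of_le (hk n)).trans (length_quotient_comap_le f _)⟩

/-- The cokernel of the induced map `M/JM → N/JN` is a quotient of `N/f(M)`, whatever `J` is. -/
theorem length_quotient_smul_le_add (J : Ideal R) (f : M →ₗ[R] N) :
    Module.length R (N ⧸ J • (⊤ : Submodule R N)) ≤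
      Module.length R (M ⧸ J • (⊤ : Submodule R M)) + Module.length R (N ⧸ LinearMap.range f) := by
  let g := Submodule.mapQ _ _ f (smul_top_le_comap J f)
  rw [Module.length_eq_add_of_exact (LinearMap.range g).subtype (LinearMap.range g).mkQ
    (Submodule.subtype_injective _) (Submodule.mkQ_surjective _)
    (LinearMap.exact_subtype_mkQ _)]
  refine add_le_add (Module.length_le_of_surjective _ g.surjective_rangeRestrict) ?_
  refine Module.length_le_of_surjective (Submodule.mapQ (LinearMap.range f) (LinearMap.range g)
    (Submodule.mkQ _) ?_) ?_
  · rintro _ ⟨m, rfl⟩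
    exact ⟨Submodule.mkQ _ m, rfl⟩
  · intro y
    obtain ⟨y, rfl⟩ := Submodule.mkQ_surjective _ y
    obtain ⟨y, rfl⟩ := Submodule.mkQ_surjective _ y
    exact ⟨Submodule.mkQ _ y, rfl⟩

end Comparison

/-! ### Primary ideals in a Noetherian local ring -/

section Local

variable {R : Type*} [CommRing R] [IsLocalRing R] [IsNoetherianRing R]

theorem length_quotient_pow_ne_top {I : Ideal R} (hI : I.radical = IsLocalRing.maximalIdeal R)
    (M : Type*) [AddCommGroup M] [Module R M] [Module.Finite R M] (n : ℕ) :
    Module.length R (M ⧸ I ^ n • (⊤ : Submodule R M)) ≠ ⊤ := by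
  have hart : IsArtinianRing (R ⧸ I ^ n) := by
    rw [isArtinianRing_iff_krullDimLE_zero, Ring.krullDimLE_zero_iff]
    intro p hp
    have hq : (p.comap (Ideal.Quotient.mk (I ^ n))).IsPrime := hp.comap _
    have hle : I ^ n ≤ p.comap (Ideal.Quotient.mk (I ^ n)) := by
      conv_lhs => rw [← Ideal.mk_ker (I := I ^ n)]
      exact Ideal.ker_le_comap _
    have hmq : IsLocalRing.maximalIdeal R ≤ p.comap (Ideal.Quotient.mk (I ^ n)) := by
      rw [← hI]
      exact hq.radical_le_iff.2 (hq.le_of_pow_le hle)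
    have hmax : (p.comap (Ideal.Quotient.mk (I ^ n))).IsMaximal := by
      rw [← (IsLocalRing.maximalIdeal.isMaximal R).eq_of_le hq.ne_top hmq]
      exact IsLocalRing.maximalIdeal.isMaximal R
    exact Ideal.isMaximal_of_isIntegral_of_isMaximal_comap' _
      (RingHom.isIntegral_of_surjective _ Ideal.Quotient.mk_surjective) p hmax
  have : Module.Finite (R ⧸ I ^ n) (M ⧸ I ^ n • (⊤ : Submodule R M)) :=
    Module.Finite.of_restrictScalars_finite R _ _
  rw [Module.length_eq_of_surjective (R := R ⧸ I ^ n) Ideal.Quotient.mk_surjective]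
  exact Module.length_ne_top

/-- Otherwise Nakayama gives `I ^ n = 0`, so every prime contains `I` and is maximal, forcing
dimension zero. -/
theorem not_pow_le_pow_succ {I : Ideal R} (hI : I.radical = IsLocalRing.maximalIdeal R)
    (hdim : 1 ≤ ringKrullDim R) (n : ℕ) : ¬ I ^ n ≤ I ^ (n + 1) := by
  intro h
  have hIm : I ≤ IsLocalRing.maximalIdeal R := hI ▸ Ideal.le_radical
  have h0 : I ^ n = ⊥ := by
    refine Submodule.eq_bot_of_le_smul_of_le_jacobson_bot I _ (IsNoetherian.noetherian _) ?_
      (hIm.trans (IsLocalRing.maximalIdeal_le_jacobson _))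
    rwa [smul_eq_mul, ← pow_succ']
  have : Ring.KrullDimLE 0 R := by
    rw [Ring.krullDimLE_zero_iff]
    intro p hp
    have hp' : IsLocalRing.maximalIdeal R ≤ p := by
      rw [← hI]
      exact hp.radical_le_iff.2 (hp.le_of_pow_le (n := n) (h0 ▸ bot_le))
    rw [← (IsLocalRing.maximalIdeal.isMaximal R).eq_of_le hp.ne_top hp']
    exact IsLocalRing.maximalIdeal.isMaximal R
  have h1 := Ring.krullDimLE_iff.1 this
  exact absurd (hdim.trans h1) (by norm_num)

end Local

/-- A finite birational extension embeds `R`-linearly into `R`. -/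
theorem IsBirational.exists_injective {R S : Type*} [CommRing R] [CommRing S] [Algebra R S]
    [Module.Finite R S] (h : IsBirational R S) :
    ∃ f : S →ₗ[R] R, Function.Injective f := by
  obtain ⟨-, φ, hφ⟩ := h
  obtain ⟨s, hs⟩ := Module.Finite.fg_top (R := R) (M := S)
  -- A common denominator of the module generators; multiplying by it moves all of `S` into `R`,
  -- injectively because it becomes a unit in the fraction ring.
  obtain ⟨b, hb⟩ := IsLocalization.exist_integer_multiples (nonZeroDivisors R) s φ
  let g : S →ₗ[R] FractionRing R := (b : R) • φ.toLinearMap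
  have hg : ∀ y, g y ∈ LinearMap.range (Algebra.linearMap R (FractionRing R)) := by
    have : (⊤ : Submodule R S) ≤
        (LinearMap.range (Algebra.linearMap R (FractionRing R))).comap g := by
      rw [← hs, Submodule.span_le]
      intro y hy
      obtain ⟨r, hr⟩ := hb y hy
      exact ⟨r, hr⟩
    exact fun y => this trivial
  let e := LinearEquiv.ofInjective (Algebra.linearMap R (FractionRing R))
    (IsFractionRing.injective R (FractionRing R))
  refine ⟨e.symm.toLinearMap ∘ₗ g.codRestrict _ hg, ?_⟩
  refine e.symm.injective.comp fun y z hyz => hφ ?_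
  have hyz' : (b : R) • φ y = (b : R) • φ z := congrArg Subtype.val hyz
  rw [Algebra.smul_def, Algebra.smul_def] at hyz'
  exact (IsLocalization.map_units (FractionRing R) b).mul_left_cancel hyz'

/-! ### The two Hilbert polynomials and their comparison -/

theorem exists_isHilbertPolynomial_moduleLength {R : Type*} [CommRing R] [IsLocalRing R]
    [IsNoetherianRing R] {I : Ideal R} (hI : I.radical = IsLocalRing.maximalIdeal R)
    (M : Type*) [AddCommGroup M] [Module R M] [Module.Finite R M] :
    ∃ P ∈ numericalPolynomials, IsHilbertPolynomial (moduleLength I M) P := by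
  have hfin : ∀ n, Module.length R (M ⧸ (I.stableFiltration (⊤ : Submodule R M)).N n) ≠ ⊤ :=
    length_quotient_pow_ne_top hI M
  obtain ⟨P, hP, h⟩ := exists_isHilbertPolynomial_of_stable (I.stableFiltration_stable ⊤) hfin
  exact ⟨P, hP, h⟩

theorem exists_isHilbertPolynomial_filtrationLength {R : Type*} [CommRing R] [IsLocalRing R]
    [IsNoetherianRing R] {I : Ideal R} (hI : I.radical = IsLocalRing.maximalIdeal R)
    {B : ℕ → Ideal R} (hB : IsIdealFiltration B) (hadm : IsAdmissible I B) :
    ∃ P ∈ numericalPolynomials, IsHilbertPolynomial (filtrationLength B) P := by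
  obtain ⟨k, hk⟩ := hadm
  have hIB : I ≤ B 1 := by simpa using (hk 1).2
  let F : I.Filtration R :=
    { N := B
      mono := fun n => hB.antitone (Nat.le_succ n)
      smul_le := fun n => by
        rw [smul_eq_mul, add_comm]
        exact (Ideal.mul_mono_left hIB).trans (hB.mul_le 1 n) }
  -- Admissibility puts `B n` inside `I ^ (n - k)`, with truncated subtraction. This filtration is
  -- stable, and stability passes to filtrations below it.
  let G : I.Filtration R :=
    { N := fun n => I ^ (n - k)
      mono := fun n => Ideal.pow_le_pow_right (by omega)
      smul_le := fun n => by
        rw [smul_eq_mul, ← pow_succ']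
        exact Ideal.pow_le_pow_right (by omega) }
  have hG : G.Stable := ⟨k, fun n hn => by
    change I • I ^ (n - k) = I ^ (n + 1 - k)
    rw [smul_eq_mul, ← pow_succ', show n - k + 1 = n + 1 - k by omega]⟩
  have hF : F.Stable := hG.of_le (F' := F) fun n => by
    change B n ≤ I ^ (n - k)
    rcases le_total k n with h | h
    · simpa [Nat.sub_add_cancel h] using (hk (n - k)).1
    · simp [Nat.sub_eq_zero_of_le h]
  have hfin : ∀ n, Module.length R (R ⧸ F.N n) ≠ ⊤ := fun n => by
    refine ne_top_of_le_ne_top (length_quotient_pow_ne_top hI R n) (length_quotient_le_of_le ?_)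
    rw [smul_eq_mul, Ideal.mul_top]
    exact (hk n).2
  obtain ⟨P, hP, h⟩ := exists_isHilbertPolynomial_of_stable hF hfin
  exact ⟨P, hP, h⟩

/-- A Hilbert polynomial of a filtration admissible over an `𝔪`-primary ideal is not constant. -/
theorem one_le_natDegree {R : Type*} [CommRing R] [IsLocalRing R]
    [IsNoetherianRing R] (hdim : 1 ≤ ringKrullDim R) {I : Ideal R}
    (hI : I.radical = IsLocalRing.maximalIdeal R)
    {B : ℕ → Ideal R} (hB : IsIdealFiltration B) (hadm : IsAdmissible I B) {P : ℚ[X]}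
    (hP : IsHilbertPolynomial (filtrationLength B) P) : 1 ≤ P.natDegree := by
  obtain ⟨k, hk⟩ := hadm
  by_contra! h
  have hC := eq_C_of_natDegree_eq_zero (Nat.lt_one_iff.1 h)
  obtain ⟨N, hN⟩ := eventually_atTop.1 hP
  obtain ⟨a, ha, haP⟩ := hN N le_rfl
  -- The gap exceeds `k`: equal lengths give `B (N + 1) = B (N + 3 + k)`, which lies in `I ^ (N +
  -- 3)`, whence `I ^ (N + 1) ≤ I ^ (N + 2)`.
  obtain ⟨b, hb, hbP⟩ := hN (N + 1 + k + 1) (by omega)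
  rw [hC, eval_C] at haP hbP
  have hab : a = b := by exact_mod_cast haP.symm.trans hbP
  subst hab
  have hle : B (N + 1 + k + 1 + 1) ≤ B (N + 1) := hB.antitone (by omega)
  have hadd := Module.length_eq_add_of_exact (R := R)
    (LinearMap.ker (Submodule.factor hle)).subtype (Submodule.factor hle)
    (Submodule.subtype_injective _) (Submodule.factor_surjective hle)
    (LinearMap.exact_subtype_ker_map _)
  rw [filtrationLength] at ha hb
  rw [ha, hb] at hadd
  have h0 : Module.length R (LinearMap.ker (Submodule.factor hle)) = 0 := by
    generalize Module.length R (LinearMap.ker (Submodule.factor hle)) = l at hadd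
    induction l using ENat.recTopCoe with
    | top => simp at hadd
    | coe l =>
      norm_cast at hadd ⊢
      omega
  rw [Module.length_eq_zero_iff] at h0
  have hBB : B (N + 1) ≤ B (N + 1 + k + 1 + 1) := by
    intro r hr
    have hmem : Submodule.Quotient.mk r ∈ LinearMap.ker (Submodule.factor hle) := by
      rw [LinearMap.mem_ker]
      exact (Submodule.Quotient.mk_eq_zero _).2 hr
    have := congrArg Subtype.val (Subsingleton.elim
      (⟨_, hmem⟩ : LinearMap.ker (Submodule.factor hle)) 0)
    exact (Submodule.Quotient.mk_eq_zero _).1 this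
  refine not_pow_le_pow_succ hI hdim (N + 1) ?_
  refine ((hk (N + 1)).2.trans hBB).trans ?_
  rw [show N + 1 + k + 1 + 1 = N + 1 + 1 + 1 + k by omega]
  exact (hk _).1.trans (Ideal.pow_le_pow_right (by omega))

theorem exists_length_quotient_le_add {R S : Type*} [CommRing R] [IsNoetherianRing R]
    [CommRing S] [Algebra R S] [Module.Finite R S]
    (hRS : IsOfFiniteLength R S ∨ IsBirational R S) (I : Ideal R) :
    ∃ k c : ℕ, ∀ n, Module.length R (S ⧸ I ^ n • (⊤ : Submodule R S)) ≤
      Module.length R (R ⧸ I ^ (n + k)) + c := by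
  rcases hRS with h | h
  · refine ⟨0, (Module.length R (S ⧸ LinearMap.range (Algebra.linearMap R S))).toNat, fun n => ?_⟩
    rw [ENat.natCast_toNat h]
    have h1 := length_quotient_smul_le_add (I ^ n) (Algebra.linearMap R S)
    rwa [smul_eq_mul, Ideal.mul_top] at h1
  · obtain ⟨f, hf⟩ := h.exists_injective
    obtain ⟨k, hk⟩ := exists_length_quotient_le_of_injective I f hf
    refine ⟨k, 0, fun n => ?_⟩
    have h1 := hk n
    rw [smul_eq_mul, Ideal.mul_top] at h1
    rwa [Nat.cast_zero, add_zero]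

end ChernNumber

open ChernNumber Filter in
/-- The length functions of `B` and of `S` with respect to `I` are given by polynomials of positive
degree with integer Hilbert coefficients, and `e_1(B) ≥ e_1(I, S)`. -/
theorem mainTheorem2 {R : Type*} [CommRing R] [IsLocalRing R] [IsNoetherianRing R]
    (hdim : 1 ≤ ringKrullDim R)
    {S : Type*} [CommRing S] [Algebra R S]
    (hS : ChernNumber.IsFiniteCover R S)
    (hRS : ChernNumber.IsOfFiniteLength R S ∨ ChernNumber.IsBirational R S)
    (I : Ideal R) (hI : I.radical = IsLocalRing.maximalIdeal R)
    (B : ℕ → Ideal R) (hB : ChernNumber.IsIdealFiltration B)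
    (hadm : ChernNumber.IsAdmissible I B)
    (hcov : ∀ᶠ n : ℕ in Filter.atTop,
      ((I ^ n).map (algebraMap R S)).comap (algebraMap R S) ≤ B n) :
    (ChernNumber.IsHilbertPolynomial (ChernNumber.filtrationLength B)
        (ChernNumber.hilbertPolynomial (ChernNumber.filtrationLength B)) ∧
      ChernNumber.HasChernNumber
        (ChernNumber.hilbertPolynomial (ChernNumber.filtrationLength B))) ∧
    (ChernNumber.IsHilbertPolynomial (ChernNumber.moduleLength I S)
        (ChernNumber.hilbertPolynomial (ChernNumber.moduleLength I S)) ∧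
      ChernNumber.HasChernNumber
        (ChernNumber.hilbertPolynomial (ChernNumber.moduleLength I S))) ∧
    ChernNumber.chernNumber B ≥ ChernNumber.moduleChernNumber I S := by
  have := hS.finite
  obtain ⟨P, hP, hPS⟩ := exists_isHilbertPolynomial_moduleLength hI S
  obtain ⟨Q, hQ, hQB⟩ := exists_isHilbertPolynomial_filtrationLength hI hB hadm
  have hQdeg := one_le_natDegree hdim hI hB hadm hQB
  have hQP : ∀ᶠ n : ℕ in atTop, Q.eval (n : ℚ) ≤ P.eval (n : ℚ) := by
    -- The length functions at `n` involve the ideals at `n + 1`, so `hcov` is shifted by one.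
    filter_upwards [hPS, hQB, (tendsto_add_atTop_nat 1).eventually hcov]
      with n ⟨a, ha, haP⟩ ⟨b, hb, hbQ⟩ hn
    have hle : filtrationLength B n ≤ moduleLength I S n := by
      refine (length_quotient_le_of_le ?_).trans
        (length_quotient_comap_le (Algebra.linearMap R S) _)
      rw [Ideal.smul_top_eq_map]
      exact hn
    rw [ha, hb] at hle
    rw [haP, hbQ]
    exact_mod_cast hle
  obtain ⟨k, c, hkc⟩ := exists_length_quotient_le_add hRS I
  obtain ⟨l, hl⟩ := hadm
  -- The shift `k` comes from comparing `S` with `R`, and `l` from `B (n + l) ≤ I ^ n`.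
  have hPQ : ∀ᶠ n : ℕ in atTop, P.eval ((n : ℚ) - (k + l : ℕ)) ≤ Q.eval (n : ℚ) + c := by
    obtain ⟨N, hN⟩ := eventually_atTop.1 hPS
    filter_upwards [hQB, eventually_ge_atTop (N + (k + l))] with n ⟨b, hb, hbQ⟩ hn
    obtain ⟨m, rfl⟩ : ∃ m, n = m + (k + l) := ⟨n - (k + l), by omega⟩
    obtain ⟨a, ha, haP⟩ := hN m (by omega)
    have hle : moduleLength I S m ≤ filtrationLength B (m + (k + l)) + c := by
      refine (hkc (m + 1)).trans (add_le_add_left (length_quotient_le_of_le ?_) _)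
      rw [show m + (k + l) + 1 = m + 1 + k + l by omega]
      exact (hl _).1
    rw [ha, hb] at hle
    rw [Nat.cast_add m, add_sub_cancel_right, haP, ← Nat.cast_add, hbQ]
    exact_mod_cast hle
  obtain ⟨hPdeg, hle⟩ := hilbertCoeff_one_le hP hQ hQdeg hQP (k + l) c hPQ
  rw [chernNumber, moduleChernNumber, hilbertPolynomial_eq hPS, hilbertPolynomial_eq hQB]
  exact ⟨⟨hQB, hQdeg, isHilbertCoeff_hilbertCoeff hQ⟩,
    ⟨hPS, hPdeg, isHilbertCoeff_hilbertCoeff hP⟩, hle⟩
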